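/- Let $n$ and $k$ be positive integers and let $P_n$ be the path on $n$ vertices, with graph distance $d$. For a set $A$ of vertices of $P_n$ let $W(A)=\sum_{\{u,v\}}d(u,v)$, the sum being over all two-element subsets $\{u,v\}$ of $A$. For a (not necessarily proper) coloring $f:V(P_n)\to\{1,\dots,k\}$ let $W(f)=\sum_{i=1}^k W(f^{-1}(i))$, and let $\mathrm{type}(f)$ be the $k$-tuple of the cardinalities $|f^{-1}(1)|,\dots,|f^{-1}(k)|$ arranged in non-decreasing order. Call $f$ a $k$-color weak maximizer of $W$ on $P_n$ if $f$ is surjective and $W(f)\ge W(g)$ for every surjective $g:V(P_n)\to\{1,\dots,k\}$ with $\mathrm{type}(g)=\mathrm{type}(f)$. For $x,y\in\mathbb{R}^k$ with components in non-increasing order $x_{[1]}\ge\dots\ge x_{[k]}$ and $y_{[1]}\ge\dots\ge y_{[k]}$, say that $x$ is majorized by $y$, written $x\prec y$, if $\sum_{j=1}^s x_{[j]}\le\sum_{j=1}^s y_{[j]}$ for $s=1,\dots,k-1$ and $\sum_{j=1}^k x_{[j]}=\sum_{j=1}^k y_{[j]}$. Suppose that $f,f':V(P_n)\to\{1,\dots,k\}$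 are $k$-color weak maximizers of $W$ on $P_n$. If $\mathrm{type}(f)\prec\mathrm{type}(f')$ and $\mathrm{type}(f)\ne\mathrm{type}(f')$, then $W(f)<W(f')$. -/

import Mathlib

/-- The Wiener index of a set `A` of vertices of `G`: the sum of the distances `d_G(u, v)` over all
two-element subsets `{u, v}` of `A`. -/
noncomputable def wienerSet {V : Type*} [DecidableEq V] (G : SimpleGraph V) (A : Finset V) : ℕ :=
  ∑ e ∈ A.sym2 with ¬ e.IsDiag, Sym2.lift ⟨G.dist, fun _ _ => SimpleGraph.dist_comm⟩ e

/-- The colour class `f⁻¹(i)` of a colouring `f` (not assumed to be proper). -/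
def colorClass {V : Type*} [Fintype V] {k : ℕ} (f : V → Fin k) (i : Fin k) : Finset V :=
  {v | f v = i}

/-- The components of a tuple, arranged in non-decreasing order. -/
def sortIncreasing {α : Type*} [LinearOrder α] {k : ℕ} (x : Fin k → α) : Fin k → α :=
  fun i => x (Tuple.sort x i)

/-- The components of a tuple, arranged in non-increasing order. -/
def sortDecreasing {α : Type*} [LinearOrder α] {k : ℕ} (x : Fin k → α) : Fin k → α :=
  fun i => sortIncreasing x i.rev

/-- The type of a colouring: the cardinalities of the colour classes in non-decreasing order. -/
def colorType {V : Type*} [Fintype V] {k : ℕ} (f : V → Fin k) : Fin k → ℕ :=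
  sortIncreasing fun i => (colorClass f i).card

/-- The Wiener index of a colouring: the sum of the Wiener indices of its colour classes. -/
noncomputable def wienerColoring {V : Type*} [Fintype V] [DecidableEq V] (G : SimpleGraph V)
    {k : ℕ} (f : V → Fin k) : ℕ :=
  ∑ i, wienerSet G (colorClass f i)

/-- `f` is a `k`-color weak maximizer of `W` on `G`: it is surjective, and its Wiener index is the
largest among all surjective colourings of the same type. -/
def IsWeakMaximizer {V : Type*} [Fintype V] [DecidableEq V] (G : SimpleGraph V)
    {k : ℕ} (f : V → Fin k) : Prop :=
  Function.Surjective f ∧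
    ∀ g : V → Fin k, Function.Surjective g → colorType g = colorType f →
      wienerColoring G g ≤ wienerColoring G f

/-- The majorization order on `ℝ^k`: `x` is majorized by `y`. The sum over the indices `j` with
`j < s` (numbered from `0`) is the sum of the `s` largest components. -/
def MajorizedBy {k : ℕ} (x y : Fin k → ℝ) : Prop :=
  (∀ s : ℕ, 1 ≤ s → s ≤ k - 1 →
    ∑ j : Fin k with j.val < s, sortDecreasing x j
      ≤ ∑ j : Fin k with j.val < s, sortDecreasing y j) ∧
  ∑ j, sortDecreasing x j = ∑ j, sortDecreasing y j

open Finset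

/-! On a path, `W` is a sum over cuts: a class of size `a` with `p` vertices before a cut
contributes `p * (a - p)`. Passing a vertex of rank `l` in its class changes the cut value by `a - 1
- 2 * l`, so the multiset of gains depends only on the class sizes, and each cut value is a prefix
sum of gains.

Hence the cut value after `m` vertices is at most the sum of the `m` largest gains, which is the
minimum over `t` of `m * t + ∑ max (gain - t) 0` (`cutValue_le`, `exists_threshold`). Ordering
vertices by decreasing gain attains this at every cut at once (`sum_gain_comp_le_cutValue`). By
`gainSum_convex` and Karamata, these bounds grow under majorization. Equality in `W` forces equal
gains, and the gains determine the type. -/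

/-! ### Convexity and Karamata's inequality over the integers -/

theorem sum_mul_nonneg_of_antitone {c d : ℕ → ℤ} {k : ℕ}
    (hc : ∀ i, i + 1 < k → c (i + 1) ≤ c i)
    (hd : ∀ s, s < k → 0 ≤ ∑ i ∈ range s, d i) (hk : ∑ i ∈ range k, d i = 0) :
    0 ≤ ∑ i ∈ range k, c i * d i := by
  -- Abel summation: a nonnegative partial sum allows `c s` to be lowered to `c (s + 1)`.
  have key : ∀ s, s + 1 ≤ k → c s * ∑ i ∈ range (s + 1), d i ≤ ∑ i ∈ range (s + 1), c i * d i := by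
    intro s
    induction s with
    | zero => intro _; simp
    | succ s ih =>
      intro hs
      rw [sum_range_succ, sum_range_succ (fun i => c i * d i)]
      have h1 := ih (by omega)
      have h2 := mul_le_mul_of_nonneg_right (hc s (by omega)) (hd (s + 1) (by omega))
      linarith
  rcases k with _ | k
  · simp
  · have := key k le_rfl
    rwa [hk, mul_zero] at this

/-- A sequence with nondecreasing increments lies above its supporting lines. -/
theorem mul_sub_le_sub_of_convex {h : ℕ → ℤ} (hh : ∀ z, h (z + 1) - h z ≤ h (z + 2) - h (z + 1))
    (x y : ℕ) : (h (x + 1) - h x) * ((y : ℤ) - x) ≤ h y - h x := by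
  have mono : Monotone fun z => h (z + 1) - h z := monotone_nat_of_le_succ hh
  rcases le_total x y with hxy | hxy
  · obtain ⟨e, rfl⟩ := Nat.exists_eq_add_of_le hxy
    induction e with
    | zero => simp
    | succ e ih =>
      have h1 := ih (by omega)
      have h2 := mono (show x ≤ x + e by omega)
      simp only [← add_assoc] at *
      push_cast at *
      linarith
  · obtain ⟨e, rfl⟩ := Nat.exists_eq_add_of_le hxy
    clear hxy
    induction e with
    | zero => simp
    | succ e ih =>
      have h2 := mono (show y + e ≤ y + (e + 1) by omega)
      simp only [← add_assoc] at *
      push_cast at *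
      nlinarith

/-- Karamata's inequality for sequences of natural numbers; only `x` needs to be nonincreasing. -/
theorem sum_le_sum_of_convex_of_partialSums {h : ℕ → ℤ}
    (hh : ∀ z, h (z + 1) - h z ≤ h (z + 2) - h (z + 1)) {x y : ℕ → ℕ} {k : ℕ}
    (hx : ∀ i, i + 1 < k → x (i + 1) ≤ x i)
    (hs : ∀ s, s < k → ∑ i ∈ range s, x i ≤ ∑ i ∈ range s, y i)
    (hk : ∑ i ∈ range k, x i = ∑ i ∈ range k, y i) :
    ∑ i ∈ range k, h (x i) ≤ ∑ i ∈ range k, h (y i) := by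
  have mono : Monotone fun z => h (z + 1) - h z := monotone_nat_of_le_succ hh
  have h0 := sum_mul_nonneg_of_antitone (k := k) (c := fun i => h (x i + 1) - h (x i))
    (d := fun i => (y i : ℤ) - x i) (fun i hi => mono (hx i hi))
    (fun s hsk => by
      have := hs s hsk
      rw [sum_sub_distrib, sub_nonneg]
      exact_mod_cast this)
    (by rw [sum_sub_distrib, sub_eq_zero]; exact_mod_cast hk.symm)
  have h1 : ∑ i ∈ range k, (h (x i + 1) - h (x i)) * ((y i : ℤ) - x i)
      ≤ ∑ i ∈ range k, (h (y i) - h (x i)) :=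
    sum_le_sum fun i _ => mul_sub_le_sub_of_convex hh _ _
  rw [sum_sub_distrib] at h1
  linarith

/-! ### Sums over the gains of one class -/

/-- The sum of `G` over the marginal gains `a - 1, a - 3, …, 1 - a` of a class of size `a`. -/
def gainSum (G : ℤ → ℤ) (a : ℕ) : ℤ := ∑ l ∈ range a, G ((a : ℤ) - 1 - 2 * l)

/-- Shifting the gains for size `a + 1` up by one gives those for `a + 2` without `-a - 1`; shifting
them down gives those for `a` together with `-a - 1`. Convexity of `G` compares the shifts. -/
theorem gainSum_convex {G : ℤ → ℤ} (hG : ∀ z, 2 * G z ≤ G (z + 1) + G (z - 1)) (a : ℕ) :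
    gainSum G (a + 1) - gainSum G a ≤ gainSum G (a + 2) - gainSum G (a + 1) := by
  have h1 : gainSum G (a + 2) = ∑ l ∈ range (a + 1), G ((a : ℤ) - 2 * l + 1) + G (-a - 1) := by
    rw [gainSum, sum_range_succ]
    congr 1
    · exact sum_congr rfl fun l _ => congrArg G (by push_cast; ring)
    · exact congrArg G (by push_cast; ring)
  have h2 : gainSum G a + G (-a - 1) = ∑ l ∈ range (a + 1), G ((a : ℤ) - 2 * l - 1) := by
    rw [gainSum, sum_range_succ]
    congr 1
    · exact sum_congr rfl fun l _ => congrArg G (by ring)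
    · exact congrArg G (by ring)
  have h3 : gainSum G (a + 1) = ∑ l ∈ range (a + 1), G ((a : ℤ) - 2 * l) :=
    sum_congr rfl fun l _ => congrArg G (by push_cast; ring)
  have h4 : ∑ l ∈ range (a + 1), 2 * G ((a : ℤ) - 2 * l) ≤
      ∑ l ∈ range (a + 1), (G ((a : ℤ) - 2 * l + 1) + G ((a : ℤ) - 2 * l - 1)) :=
    sum_le_sum fun l _ => hG _
  rw [← mul_sum, sum_add_distrib] at h4
  linarith

/-- Consecutive gains differ by two, so the sum telescopes. -/
theorem gainSum_sub_shift (F : ℤ → ℤ) (a : ℕ) :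
    gainSum (fun z => F (z + 1) - F (z - 1)) a = F a - F (-a) := by
  have h := sum_range_sub' (fun l : ℕ => F ((a : ℤ) - 2 * l)) a
  have e1 : (a : ℤ) - 2 * (a : ℕ) = -a := by ring
  simp only [e1, Nat.cast_zero, mul_zero, sub_zero] at h
  rw [← h]
  refine sum_congr rfl fun l _ => ?_
  change F _ - F _ = F _ - F _
  congr 2 <;> push_cast <;> ring

theorem sum_range_gain (a l : ℕ) : ∑ i ∈ range l, ((a : ℤ) - 1 - 2 * i) = l * (a - l) := by
  induction l with
  | zero => simp
  | succ l ih => rw [sum_range_succ, ih]; push_cast; ring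

theorem sum_range_card_le_sum (s : Finset ℕ) : ∑ i ∈ range #s, i ≤ ∑ i ∈ s, i := by
  induction s using Finset.induction_on_max with
  | empty => simp
  | insert m s hm ih =>
    have hms : m ∉ s := fun h => lt_irrefl _ (hm m h)
    rw [card_insert_of_notMem hms, sum_insert hms, sum_range_succ]
    have : #s ≤ m := by
      simpa using card_le_card (show s ⊆ range m from fun i hi => mem_range.2 (hm i hi))
    omega

theorem sum_gain_le (a : ℕ) (s : Finset ℕ) :
    ∑ i ∈ s, ((a : ℤ) - 1 - 2 * i) ≤ #s * (a - #s) := by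
  rw [← sum_range_gain]
  simp only [sum_sub_distrib, ← mul_sum]
  have h := Nat.cast_le (α := ℤ).2 (sum_range_card_le_sum s)
  rw [Nat.cast_sum, Nat.cast_sum] at h
  simp only [sum_const, card_range]
  linarith

/-! ### Distances on the path as counts of separating cuts -/

theorem pathGraph_dist {n : ℕ} {u v : Fin n} (h : u ≤ v) :
    (SimpleGraph.pathGraph n).dist u v = v.val - u.val := by
  apply le_antisymm
  · obtain ⟨u, hu⟩ := u
    obtain ⟨v, hv⟩ := v
    obtain ⟨e, rfl⟩ := Nat.exists_eq_add_of_le (show u ≤ v from h)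
    suffices ∃ p : (SimpleGraph.pathGraph n).Walk ⟨u, hu⟩ ⟨u + e, hv⟩, p.length = e by
      obtain ⟨p, hp⟩ := this
      have := SimpleGraph.dist_le p
      simp only
      omega
    clear h
    induction e with
    | zero => exact ⟨.nil, rfl⟩
    | succ e ih =>
      obtain ⟨p, hp⟩ := ih (by omega)
      refine ⟨p.concat (SimpleGraph.pathGraph_adj.2 (Or.inl ?_)), by simp [hp]⟩
      simp [add_assoc]
  · obtain ⟨p, hp⟩ := (SimpleGraph.pathGraph_preconnected n u v).exists_walk_length_eq_dist
    rw [← hp]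
    clear hp h
    induction p with
    | nil => simp
    | cons hadj p ih =>
      rw [SimpleGraph.pathGraph_adj] at hadj
      rw [SimpleGraph.Walk.length_cons]
      omega

theorem wienerSet_pathGraph {n : ℕ} (A : Finset (Fin n)) :
    (wienerSet (SimpleGraph.pathGraph n) A : ℤ) =
      ∑ m ∈ range n, (#{u ∈ A | u.val < m} : ℤ) * (#A - #{u ∈ A | u.val < m}) := by
  rw [wienerSet, sum_sym2_filter_not_isDiag]
  have h1 : ∀ p ∈ ({p ∈ A.offDiag | p.1 < p.2} : Finset _),
      Sym2.lift ⟨(SimpleGraph.pathGraph n).dist, fun _ _ => SimpleGraph.dist_comm⟩ s(p.1, p.2)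
        = ∑ m ∈ range n, if p.1.val < m ∧ ¬ p.2.val < m then 1 else 0 := by
    intro p hp
    rw [Sym2.lift_mk]
    change (SimpleGraph.pathGraph n).dist p.1 p.2 = _
    rw [pathGraph_dist (mem_filter.1 hp).2.le, ← card_filter, ← Nat.card_Ioc]
    congr 1
    ext m
    have := p.2.isLt
    simp only [mem_Ioc, mem_filter, mem_range]
    omega
  rw [sum_congr rfl h1, sum_comm, Nat.cast_sum]
  refine sum_congr rfl fun m _ => ?_
  have h2 : #{u ∈ A | ¬ u.val < m} + #{u ∈ A | u.val < m} = #A := by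
    rw [add_comm]; exact card_filter_add_card_filter_not _
  rw [← card_filter, ← h2, Nat.cast_add, add_sub_cancel_right, ← Nat.cast_mul, ← card_product]
  congr 2
  ext ⟨u, v⟩
  simp only [mem_filter, mem_offDiag, mem_product, Fin.lt_def, ne_eq]
  constructor
  · rintro ⟨⟨⟨a, b, c⟩, d⟩, e, g⟩
    exact ⟨⟨a, e⟩, b, g⟩
  · rintro ⟨⟨a, e⟩, b, g⟩
    refine ⟨⟨⟨a, b, ?_⟩, by omega⟩, e, g⟩
    rintro rfl
    exact g e

/-! ### Cut values and gains of a colouring -/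

section Coloring

variable {n k : ℕ} (f : Fin n → Fin k)

/-- The number of vertices of colour `i` among the first `m` vertices. -/
def prefixCount (i : Fin k) (m : ℕ) : ℕ := #{u : Fin n | u.val < m ∧ f u = i}

/-- The number of vertices preceding `u` in its colour class. -/
def classRank (u : Fin n) : ℕ := prefixCount f (f u) u

/-- The contribution to the Wiener index of the cut after the first `m` vertices. -/
def cutValue (m : ℕ) : ℤ :=
  ∑ i, (prefixCount f i m : ℤ) * (#(colorClass f i) - prefixCount f i m)

/-- The increase of `cutValue` when the vertex `u` is passed. -/
def gain (u : Fin n) : ℤ := (#(colorClass f (f u)) : ℤ) - 1 - 2 * classRank f u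

theorem wienerColoring_eq_sum_cutValue :
    (wienerColoring (SimpleGraph.pathGraph n) f : ℤ) = ∑ m ∈ range n, cutValue f m := by
  simp only [cutValue]
  rw [wienerColoring, Nat.cast_sum, sum_comm]
  refine sum_congr rfl fun i _ => ?_
  rw [wienerSet_pathGraph]
  refine sum_congr rfl fun m _ => ?_
  have : #{u ∈ colorClass f i | u.val < m} = prefixCount f i m := by
    rw [prefixCount, colorClass, filter_filter]
    simp only [and_comm]
  rw [this]

theorem filter_val_lt_succ (u : Fin n) :
    ({v : Fin n | v.val < u.val + 1} : Finset (Fin n)) = insert u ({v | v.val < u.val} : Finset _) := by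
  ext v
  simp only [mem_filter, mem_insert, mem_univ, true_and, Fin.ext_iff]
  omega

theorem prefixCount_zero (i : Fin k) : prefixCount f i 0 = 0 := by simp [prefixCount]

theorem prefixCount_full (i : Fin k) : prefixCount f i n = #(colorClass f i) := by
  simp [prefixCount, colorClass]

theorem prefixCount_mono (i : Fin k) : Monotone (prefixCount f i) := fun a b h =>
  card_le_card fun u hu => by
    simp only [mem_filter, mem_univ, true_and] at hu ⊢
    exact ⟨by omega, hu.2⟩

theorem prefixCount_succ (u : Fin n) (i : Fin k) :
    prefixCount f i (u.val + 1) = prefixCount f i u.val + if f u = i then 1 else 0 := by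
  have h (m : ℕ) : prefixCount f i m = ∑ v : Fin n with v.val < m, if f v = i then 1 else 0 := by
    rw [← card_filter, filter_filter]; rfl
  rw [h, h, filter_val_lt_succ, sum_insert (by simp), add_comm]

/-- In any prefix, the ranks occurring in a colour form an initial segment of `ℕ`. -/
theorem sum_classRank (Φ : Fin k → ℕ → ℤ) {m : ℕ} (hm : m ≤ n) :
    ∑ u : Fin n with u.val < m, Φ (f u) (classRank f u) =
      ∑ i, ∑ l ∈ range (prefixCount f i m), Φ i l := by
  induction m with
  | zero => simp [prefixCount_zero]
  | succ m ih =>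
    have h := prefixCount_succ f ⟨m, hm⟩
    have h' := filter_val_lt_succ (⟨m, hm⟩ : Fin n)
    simp only at h h'
    rw [h', sum_insert (by simp), ih (by omega), add_comm]
    have : ∀ i, ∑ l ∈ range (prefixCount f i (m + 1)), Φ i l =
        ∑ l ∈ range (prefixCount f i m), Φ i l +
          if f ⟨m, hm⟩ = i then Φ i (prefixCount f i m) else 0 := by
      intro i
      rw [h]
      split_ifs <;> simp [sum_range_succ]
    simp only [this, sum_add_distrib, sum_ite_eq, mem_univ, if_true]
    rfl

theorem sum_gain_prefix {m : ℕ} (hm : m ≤ n) :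
    ∑ u : Fin n with u.val < m, gain f u = cutValue f m := by
  have := sum_classRank f (fun i l => (#(colorClass f i) : ℤ) - 1 - 2 * l) hm
  simp only [sum_range_gain] at this
  exact this

theorem sum_comp_gain (G : ℤ → ℤ) :
    ∑ u, G (gain f u) = ∑ i, gainSum G #(colorClass f i) := by
  have := sum_classRank f (fun i l => G ((#(colorClass f i) : ℤ) - 1 - 2 * l)) le_rfl
  simpa [prefixCount_full, gainSum, gain] using this

theorem cutValue_le (t : ℤ) {m : ℕ} (hm : m ≤ n) :
    cutValue f m ≤ m * t + ∑ i, gainSum (fun z => max (z - t) 0) #(colorClass f i) := by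
  rw [← sum_gain_prefix f hm, ← sum_comp_gain]
  have h1 : ∑ u : Fin n with u.val < m, gain f u ≤
      ∑ u : Fin n with u.val < m, (t + max (gain f u - t) 0) :=
    sum_le_sum fun u _ => by linarith [le_max_left (gain f u - t) 0]
  have h2 : ∑ u : Fin n with u.val < m, max (gain f u - t) 0 ≤ ∑ u, max (gain f u - t) 0 :=
    sum_le_sum_of_subset_of_nonneg (subset_univ _) fun _ _ _ => le_max_right _ _
  have h3 : #{u : Fin n | u.val < m} = m := by
    rw [Fin.card_filter_val_lt, min_eq_right hm]
  rw [sum_add_distrib, sum_const, h3, nsmul_eq_mul] at h1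
  linarith

theorem classRank_lt {u v : Fin n} (huv : u < v) (h : f u = f v) :
    classRank f u < classRank f v := by
  have h1 := prefixCount_succ f u (f u)
  have h2 := prefixCount_mono f (f u) (show u.val + 1 ≤ v.val from huv)
  rw [if_pos rfl] at h1
  simp only [classRank]
  rw [← h]
  omega

/-- Ranks within a class are distinct, and the smallest ranks carry the largest gains. -/
theorem sum_gain_le_of_subset (T : Finset (Fin n)) :
    ∑ u ∈ T, gain f u ≤
      ∑ i, (#{u ∈ T | f u = i} : ℤ) * (#(colorClass f i) - #{u ∈ T | f u = i}) := by
  rw [← sum_fiberwise T f]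
  refine sum_le_sum fun i _ => ?_
  have hinj : Set.InjOn (classRank f) ({u ∈ T | f u = i} : Finset (Fin n)) := by
    intro u hu v hv huv
    simp only [coe_filter, Set.mem_ofPred_eq] at hu hv
    by_contra hne
    rcases lt_or_gt_of_ne hne with h | h
    · exact (classRank_lt f h (hu.2.trans hv.2.symm)).ne huv
    · exact (classRank_lt f h (hv.2.trans hu.2.symm)).ne huv.symm
  have := sum_gain_le #(colorClass f i) (image (classRank f) {u ∈ T | f u = i})
  rw [card_image_of_injOn hinj, sum_image hinj] at this
  refine le_trans (le_of_eq (sum_congr rfl fun u hu => ?_)) this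
  rw [gain, (mem_filter.1 hu).2]

theorem card_colorClass_comp (σ : Equiv.Perm (Fin n)) (i : Fin k) :
    #(colorClass (f ∘ σ) i) = #(colorClass f i) := by
  rw [← card_map σ.toEmbedding]
  congr 1
  ext u
  simp only [colorClass, mem_map_equiv, mem_filter, mem_univ, true_and, Function.comp_apply,
    Equiv.apply_symm_apply]

theorem sum_gain_comp_le_cutValue (σ : Equiv.Perm (Fin n)) (m : ℕ) :
    ∑ u : Fin n with u.val < m, gain f (σ u) ≤ cutValue (f ∘ σ) m := by
  have h := sum_gain_le_of_subset f (map σ.toEmbedding {u : Fin n | u.val < m})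
  rw [sum_map] at h
  refine h.trans (le_of_eq (sum_congr rfl fun i _ => ?_))
  have : #{u ∈ map σ.toEmbedding {u : Fin n | u.val < m} | f u = i} = prefixCount (f ∘ σ) i m := by
    rw [filter_map, card_map, filter_filter]; rfl
  rw [this, card_colorClass_comp]

/-- If `σ` sorts the gains, some threshold turns the bound of `cutValue_le` into an equality. -/
theorem exists_threshold {σ : Equiv.Perm (Fin n)} (hσ : Antitone (gain f ∘ σ)) {m : ℕ} (hm : m ≤ n) :
    ∃ t : ℤ, ∑ u : Fin n with u.val < m, gain f (σ u) =
      m * t + ∑ i, gainSum (fun z => max (z - t) 0) #(colorClass f i) := by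
  obtain ⟨t, h1, h2⟩ : ∃ t : ℤ, (∀ u : Fin n, u.val < m → t ≤ gain f (σ u)) ∧
      ∀ u : Fin n, ¬ u.val < m → gain f (σ u) ≤ t := by
    rcases m with _ | m
    -- With an empty prefix, `t` only has to dominate every gain, so the largest gain serves.
    · rcases n with _ | n
      · exact ⟨0, fun u => u.elim0, fun u => u.elim0⟩
      · exact ⟨gain f (σ 0), fun u hu => absurd hu (by omega), fun u _ => hσ (Fin.zero_le u)⟩
    · refine ⟨gain f (σ ⟨m, hm⟩), fun u hu => hσ (Fin.le_def.2 ?_), fun u hu => hσ (Fin.le_def.2 ?_)⟩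
      · simp only; omega
      · simp only; omega
  refine ⟨t, ?_⟩
  have h3 : #{u : Fin n | u.val < m} = m := by
    rw [Fin.card_filter_val_lt, min_eq_right hm]
  rw [← sum_comp_gain, ← Equiv.sum_comp σ, ← sum_filter_add_sum_filter_not univ (fun u => u.val < m)
    (fun u => max (gain f (σ u) - t) 0)]
  have h4 : ∑ u : Fin n with ¬ u.val < m, max (gain f (σ u) - t) 0 = 0 :=
    sum_eq_zero fun u hu => max_eq_right (by linarith [h2 u (mem_filter.1 hu).2])
  have h5 : ∑ u : Fin n with u.val < m, max (gain f (σ u) - t) 0 =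
      ∑ u : Fin n with u.val < m, (gain f (σ u) - t) :=
    sum_congr rfl fun u hu => max_eq_left (by linarith [h1 u (mem_filter.1 hu).2])
  rw [h4, h5, sum_sub_distrib, sum_const, h3, nsmul_eq_mul]
  ring

end Coloring

/-! ### Majorization and recovery of the type -/

/-- The nonincreasing rearrangement of a tuple of natural numbers, as a sequence on `ℕ`. -/
theorem exists_decreasing_rearrangement {k : ℕ} (a : Fin k → ℕ) :
    ∃ X : ℕ → ℕ, (∀ i, i + 1 < k → X (i + 1) ≤ X i) ∧
      (∀ H : ℕ → ℤ, ∑ i ∈ range k, H (X i) = ∑ i, H (a i)) ∧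
      ∀ s, s ≤ k → ((∑ i ∈ range s, X i : ℕ) : ℝ) =
        ∑ j : Fin k with j.val < s, sortDecreasing (fun i => (a i : ℝ)) j := by
  set τ := Tuple.sort fun i => (a i : ℝ)
  have hmono : Monotone ((fun i => (a i : ℝ)) ∘ τ) := Tuple.monotone_sort _
  refine ⟨fun i => if h : i < k then a (τ (Fin.rev ⟨i, h⟩)) else 0, fun i hi => ?_, fun H => ?_,
    fun s hs => ?_⟩
  · have h : Fin.rev ⟨i + 1, hi⟩ ≤ Fin.rev ⟨i, (Nat.lt_succ_self i).trans hi⟩ := by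
      rw [Fin.rev_le_rev, Fin.le_def]; simp
    have := hmono h
    simp only [Function.comp_apply, Nat.cast_le] at this
    beta_reduce
    rw [dif_pos hi, dif_pos ((Nat.lt_succ_self i).trans hi)]
    exact this
  · rw [← Fin.sum_univ_eq_sum_range (fun i => H (if h : i < k then a (τ (Fin.rev ⟨i, h⟩)) else 0))]
    simp only [Fin.is_lt, dite_true, Fin.eta]
    exact Equiv.sum_comp (Fin.revPerm.trans τ) fun i => H (a i)
  · have h : ∀ j : Fin k, sortDecreasing (fun i => (a i : ℝ)) j =
        ((if h : j.val < k then a (τ (Fin.rev ⟨j, h⟩)) else 0 : ℕ) : ℝ) := fun j => by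
      rw [dif_pos j.isLt]; rfl
    simp only [h]
    rw [sum_filter, Fin.sum_univ_eq_sum_range (fun i => if i < s then
      ((if h : i < k then a (τ (Fin.rev ⟨i, h⟩)) else 0 : ℕ) : ℝ) else 0), ← sum_filter, Nat.cast_sum]
    refine sum_congr ?_ fun _ _ => rfl
    ext i
    simp only [mem_filter, mem_range]
    omega

theorem MajorizedBy.sum_le_sum_of_convex {k : ℕ} {a b : Fin k → ℕ}
    (hab : MajorizedBy (fun i => (a i : ℝ)) fun i => (b i : ℝ)) {h : ℕ → ℤ}
    (hh : ∀ z, h (z + 1) - h z ≤ h (z + 2) - h (z + 1)) : ∑ i, h (a i) ≤ ∑ i, h (b i) := by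
  obtain ⟨X, hX, hXs, hXp⟩ := exists_decreasing_rearrangement a
  obtain ⟨Y, -, hYs, hYp⟩ := exists_decreasing_rearrangement b
  rw [← hXs, ← hYs]
  refine sum_le_sum_of_convex_of_partialSums hh hX (fun s hs => ?_) ?_
  · rcases s with _ | s
    · simp
    · have := hab.1 (s + 1) (by omega) (by omega)
      rw [← hXp _ hs.le, ← hYp _ hs.le] at this
      exact_mod_cast this
  · have h1 := hXp k le_rfl
    have h2 := hYp k le_rfl
    simp only [Fin.is_lt, filter_true] at h1 h2
    have := h1.trans (hab.2.trans h2.symm)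
    exact_mod_cast this

theorem sum_comp_colorType {n k : ℕ} (f : Fin n → Fin k) (H : ℕ → ℤ) :
    ∑ i, H (colorType f i) = ∑ i, H #(colorClass f i) :=
  Equiv.sum_comp (Tuple.sort fun i => #(colorClass f i)) fun i => H #(colorClass f i)

theorem sortIncreasing_eq_of_card_fiber_eq {k : ℕ} {a b : Fin k → ℕ}
    (h : ∀ v, #{i | a i = v} = #{i | b i = v}) : sortIncreasing a = sortIncreasing b := by
  have e : ∀ v, Nonempty ({i // a i = v} ≃ {i // b i = v}) := fun v =>
    ⟨Fintype.equivOfCardEq (by rw [Fintype.card_subtype, Fintype.card_subtype, h])⟩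
  let σ : Equiv.Perm (Fin k) := Equiv.ofFiberEquiv fun v => (e v).some
  have hσ : b ∘ σ = a := funext fun i => Equiv.ofFiberEquiv_map _ i
  have := Tuple.comp_perm_comp_sort_eq_comp_sort (f := b) (σ := σ)
  rw [hσ] at this
  exact this

/-- Taking `G` to be the shifted difference of an indicator at `v` makes the sum count the classes
of size `v`. -/
theorem colorType_eq_of_sum_gainSum_eq {n k : ℕ} {f f' : Fin n → Fin k}
    (hf : Function.Surjective f) (hf' : Function.Surjective f')
    (h : ∀ G, ∑ i, gainSum G #(colorClass f i) = ∑ i, gainSum G #(colorClass f' i)) :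
    colorType f = colorType f' := by
  have pos : ∀ {g : Fin n → Fin k}, Function.Surjective g → ∀ i, 0 < #(colorClass g i) :=
    fun {g} hg i => by
      obtain ⟨u, hu⟩ := hg i
      exact card_pos.2 ⟨u, by simp [colorClass, hu]⟩
  have key : ∀ {g : Fin n → Fin k}, Function.Surjective g → ∀ v : ℕ,
      (#{i | #(colorClass g i) = v} : ℤ) = ∑ i, gainSum
        (fun z => (if z + 1 = (v : ℤ) then 1 else 0) - if z - 1 = (v : ℤ) then 1 else 0)
        #(colorClass g i) := by
    intro g hg v
    rw [card_filter, Nat.cast_sum]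
    refine sum_congr rfl fun i _ => ?_
    rw [gainSum_sub_shift (fun z => if z = (v : ℤ) then 1 else 0)]
    have := pos hg i
    -- Surjectivity excludes empty classes, where both indicators would fire at `v = 0`.
    rw [if_neg (show ¬ -(#(colorClass g i) : ℤ) = v by omega)]
    simp
  refine sortIncreasing_eq_of_card_fiber_eq fun v => ?_
  have := (key hf v).trans ((h _).trans (key hf' v).symm)
  exact_mod_cast this

theorem mainTheorem3 (n k : ℕ) (f f' : Fin n → Fin k)
    (hf : IsWeakMaximizer (SimpleGraph.pathGraph n) f)
    (hf' : IsWeakMaximizer (SimpleGraph.pathGraph n) f')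
    (hmaj : MajorizedBy (fun i => (colorType f i : ℝ)) (fun i => (colorType f' i : ℝ)))
    (hne : colorType f ≠ colorType f') :
    wienerColoring (SimpleGraph.pathGraph n) f < wienerColoring (SimpleGraph.pathGraph n) f' := by
  obtain ⟨σ, hσ⟩ : ∃ σ : Equiv.Perm (Fin n), Antitone (gain f' ∘ σ) :=
    ⟨Tuple.sort fun u => -gain f' u, fun u v huv =>
      neg_le_neg_iff.1 (Tuple.monotone_sort (fun u => -gain f' u) huv)⟩
  have hle : ∀ m, m ≤ n → cutValue f m ≤ ∑ u : Fin n with u.val < m, gain f' (σ u) := by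
    intro m hm
    obtain ⟨t, ht⟩ := exists_threshold f' hσ hm
    rw [ht]
    refine (cutValue_le f t hm).trans ?_
    have hconv := hmaj.sum_le_sum_of_convex (h := gainSum fun z => max (z - t) 0)
      (gainSum_convex fun z => by
        rcases max_cases (z - t) 0 with h | h <;> rcases max_cases (z + 1 - t) 0 with h' | h' <;>
          rcases max_cases (z - 1 - t) 0 with h'' | h'' <;> omega)
    rw [sum_comp_colorType, sum_comp_colorType] at hconv
    linarith
  have hg : wienerColoring (SimpleGraph.pathGraph n) (f' ∘ σ) ≤
      wienerColoring (SimpleGraph.pathGraph n) f' := by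
    refine hf'.2 _ (hf'.1.comp σ.surjective) ?_
    simp only [colorType, card_colorClass_comp]
  have hW : (wienerColoring (SimpleGraph.pathGraph n) f' : ℤ) ≥
      ∑ m ∈ range n, ∑ u : Fin n with u.val < m, gain f' (σ u) := by
    refine le_trans (sum_le_sum fun m _ => sum_gain_comp_le_cutValue f' σ m) ?_
    rw [← wienerColoring_eq_sum_cutValue]
    exact_mod_cast hg
  have hWf := wienerColoring_eq_sum_cutValue f
  have hsum := sum_le_sum fun m (hm : m ∈ range n) => hle m (mem_range.1 hm).le
  by_contra hlt
  have hlt' : (wienerColoring (SimpleGraph.pathGraph n) f' : ℤ) ≤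
      wienerColoring (SimpleGraph.pathGraph n) f := mod_cast not_lt.1 hlt
  -- Termwise bounds with equal totals are termwise equalities.
  have heq := (sum_eq_sum_iff_of_le fun m (hm : m ∈ range n) => hle m (mem_range.1 hm).le).1
    (by linarith)
  have total : ∀ {g : Fin n → Fin k}, ∑ u, gain g u = 0 := fun {g} => by
    have := sum_gain_prefix g le_rfl
    simpa [cutValue, prefixCount_full] using this
  have heq' : ∀ m, m ≤ n → ∑ u : Fin n with u.val < m, gain f u =
      ∑ u : Fin n with u.val < m, gain f' (σ u) := by
    intro m hm
    rcases hm.lt_or_eq with h | rfl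
    · rw [sum_gain_prefix f hm, heq m (mem_range.2 h)]
    -- The cut sum stops before `m = n`; there both sides are total gains, hence zero.
    · simp only [Fin.is_lt, filter_true]
      rw [Equiv.sum_comp σ, total, total]
  have hgain : ∀ u, gain f u = gain f' (σ u) := by
    intro u
    have h1 := heq' (u.val + 1) u.isLt
    rw [filter_val_lt_succ, sum_insert (by simp), sum_insert (by simp), heq' u.val u.isLt.le] at h1
    linarith
  refine hne (colorType_eq_of_sum_gainSum_eq hf.1 hf'.1 fun G => ?_)
  rw [← sum_comp_gain, ← sum_comp_gain, ← Equiv.sum_comp σ fun u => G (gain f' u)]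
  exact sum_congr rfl fun u _ => congrArg G (hgain u)
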